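/- Let $X,Y,Z$ be the Pauli matrices and write $X_i,Y_i,Z_i$ for their action on the $i$-th of $n$ qubits. An operator $H$ on $n$ qubits is called \emph{stoquastic} (sign problem free) if all its matrix elements in the standard basis $\{|x\rangle : x\in\{0,1\}^n\}$ are real and $\langle x|H|y\rangle\le 0$ for all $x\ne y$. For real coefficients $J=(J_{i,j})_{1\le i<j\le n}$ let $$H_J=\sum_{1\le i<j\le n}J_{i,j}\,(X_iX_j+Y_iY_j+Z_iZ_j).$$ 1. For every $n\ge 2$ and all $J$ with $J_{i,j}>0$ for all $i<j$, the Hamiltonian $H_J$ is not stoquastic. 2. There is a constant $N$ such that for every $n\ge N$, all $J$ with $J_{i,j}>0$ for all $i<j$, and all single-qubit unitaries $U_1,\dots,U_n\in \mathrm{U}(2)$, the Hamiltonian $$(U_1\otimes\cdots\otimes U_n)^\dagger\, H_J\,(U_1\otimes\cdots\otimes U_n)$$ is not stoquastic. 3. In particular this applies to the Haldane–Shastry Hamiltonian on $n\ge 2$ qubits, which is $H_J$ with $J_{i,j}=\dfrac{1}{4\left(\frac n\pi\sin\frac{\pi(i-j)}{n}\right)^2}$: these coefficients are positive for all $i<j$;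 the Haldane–Shastry Hamiltonian is not stoquastic for any $n\ge 2$; and for all sufficiently large $n$ no product unitary $U_1\otimes\cdots\otimes U_n$ makes it stoquastic. -/

import Mathlib

open scoped Matrix

noncomputable section

namespace Qubits

/-- The standard (computational) basis of `n` qubits is labelled by bit strings. -/
abbrev BitString (n : ℕ) : Type := Fin n → Fin 2

/-- Operators on `n` qubits, written as matrices in the standard basis: `⟨x|A|y⟩ = A x y`. -/
abbrev Operator (n : ℕ) : Type := Matrix (BitString n) (BitString n) ℂ

/-- The Pauli matrix `X`. -/
def pauliX : Matrix (Fin 2) (Fin 2) ℂ := !![0, 1; 1, 0]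

/-- The Pauli matrix `Y`. -/
def pauliY : Matrix (Fin 2) (Fin 2) ℂ := !![0, -Complex.I; Complex.I, 0]

/-- The Pauli matrix `Z`. -/
def pauliZ : Matrix (Fin 2) (Fin 2) ℂ := !![1, 0; 0, -1]

/-- The tensor product `A₁ ⊗ A₂ ⊗ ⋯ ⊗ Aₙ` of single-qubit operators. -/
def tensorProd {n : ℕ} (A : Fin n → Matrix (Fin 2) (Fin 2) ℂ) : Operator n :=
  Matrix.of fun x y => ∏ k, A k (x k) (y k)

/-- The single-qubit operator `P` acting on qubit `i`, with the identity on all other qubits. -/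
def onQubit {n : ℕ} (P : Matrix (Fin 2) (Fin 2) ℂ) (i : Fin n) : Operator n :=
  tensorProd (Function.update (fun _ => 1) i P)

/-- The exchange term `XᵢXⱼ + YᵢYⱼ + ZᵢZⱼ`. -/
def exchange {n : ℕ} (i j : Fin n) : Operator n :=
  onQubit pauliX i * onQubit pauliX j + onQubit pauliY i * onQubit pauliY j
    + onQubit pauliZ i * onQubit pauliZ j

/-- The Hamiltonian `∑_{i < j} Jᵢⱼ (XᵢXⱼ + YᵢYⱼ + ZᵢZⱼ)`; only `J i j` with `i < j` is used. -/
def heisenberg {n : ℕ} (J : Fin n → Fin n → ℝ) : Operator n :=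
  ∑ i, ∑ j ∈ Finset.Ioi i, (J i j : ℂ) • exchange i j

/-- The Haldane–Shastry coefficients `1 / (4 ((n/π) sin(π(i-j)/n))²)`. -/
def haldaneShastryCoupling (n : ℕ) (i j : Fin n) : ℝ :=
  1 / (4 * ((n : ℝ) / Real.pi *
    Real.sin (Real.pi * (((i : ℕ) : ℝ) - ((j : ℕ) : ℝ)) / (n : ℝ))) ^ 2)

/-- The Haldane–Shastry Hamiltonian on a ring of `n` qubits. -/
def haldaneShastry (n : ℕ) : Operator n := heisenberg (haldaneShastryCoupling n)

/-- Stoquastic (sign problem free): all matrix elements in the standard basis are real, and the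
off-diagonal ones are nonpositive. -/
def IsStoquastic {n : ℕ} (H : Operator n) : Prop :=
  (∀ x y, (H x y).im = 0) ∧ ∀ x y, x ≠ y → (H x y).re ≤ 0

/-- `H` in the product basis given by single-qubit unitaries:
`(U₁ ⊗ ⋯ ⊗ Uₙ)† H (U₁ ⊗ ⋯ ⊗ Uₙ)`. -/
def localBasisChange {n : ℕ} (U : Fin n → Matrix.unitaryGroup (Fin 2) ℂ) (H : Operator n) :
    Operator n :=
  (tensorProd fun k => (U k : Matrix (Fin 2) (Fin 2) ℂ))ᴴ * H *
    tensorProd fun k => (U k : Matrix (Fin 2) (Fin 2) ℂ)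

end Qubits

end

namespace Qubits

open Matrix

/-! Each exchange term is `2 SWAP - 1`, so in a product basis a matrix element flipping exactly bits
`i` and `j` depends only on `J i j` and the relative rotation `W = Uᵢ† Uⱼ`
(`localBasisChange_heisenberg_apply`). For `U = 1` such an element is positive, which settles the
original basis. In general, stoquasticity and unitarity force `W 1 1 = -W 0 0` and `W 1 0 = -W 0 1`,
i.e. `W` anticommutes with `X`. For three qubits `(Uᵢ† Uⱼ)(Uⱼ† Uₖ) = Uᵢ† Uₖ`, but a product of two
matrices anticommuting with `X` commutes with `X`, so all three cannot anticommute unless the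
product is zero. Hence `N = 3` works for all positive couplings. -/

theorem tensorProd_mul {n : ℕ} (A B : Fin n → Matrix (Fin 2) (Fin 2) ℂ) :
    tensorProd A * tensorProd B = tensorProd fun k => A k * B k := by
  ext x y
  simp only [tensorProd, Matrix.mul_apply, Matrix.of_apply, ← Finset.prod_mul_distrib]
  rw [Finset.prod_univ_sum, Fintype.piFinset_univ]

theorem conjTranspose_tensorProd {n : ℕ} (A : Fin n → Matrix (Fin 2) (Fin 2) ℂ) :
    (tensorProd A)ᴴ = tensorProd fun k => (A k)ᴴ := by
  ext x y
  simp [tensorProd, Matrix.conjTranspose_apply]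

theorem tensorProd_one {n : ℕ} :
    tensorProd (fun _ : Fin n => (1 : Matrix (Fin 2) (Fin 2) ℂ)) = 1 := by
  ext x y
  by_cases h : x = y
  · subst h
    simp [tensorProd]
  · obtain ⟨k, hk⟩ := Function.ne_iff.mp h
    rw [Matrix.one_apply_ne h]
    exact Finset.prod_eq_zero (Finset.mem_univ k) (Matrix.one_apply_ne hk)

theorem localBasisChange_one {n : ℕ} (H : Operator n) :
    localBasisChange (fun _ => 1) H = H := by
  simp [localBasisChange, tensorProd_one]

theorem localBasisChange_add {n : ℕ} (U : Fin n → unitaryGroup (Fin 2) ℂ) (A B : Operator n) :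
    localBasisChange U (A + B) = localBasisChange U A + localBasisChange U B := by
  simp [localBasisChange, Matrix.mul_add, Matrix.add_mul]

theorem localBasisChange_heisenberg {n : ℕ} (U : Fin n → unitaryGroup (Fin 2) ℂ)
    (J : Fin n → Fin n → ℝ) :
    localBasisChange U (heisenberg J) =
      ∑ i, ∑ j ∈ Finset.Ioi i, (J i j : ℂ) • localBasisChange U (exchange i j) := by
  simp only [localBasisChange, heisenberg, Matrix.mul_sum, Matrix.sum_mul, Matrix.mul_smul,
    Matrix.smul_mul]

/-! ### Matrix elements in a rotated product basis -/

theorem localBasisChange_two_qubit {n : ℕ} (U : Fin n → unitaryGroup (Fin 2) ℂ)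
    (P : Matrix (Fin 2) (Fin 2) ℂ) (k l : Fin n) :
    localBasisChange U (onQubit P k * onQubit P l) = tensorProd fun m =>
      (U m : Matrix (Fin 2) (Fin 2) ℂ)ᴴ *
        (Function.update (fun _ => 1) k P m * Function.update (fun _ => 1) l P m) *
        (U m : Matrix (Fin 2) (Fin 2) ℂ) := by
  simp only [localBasisChange, onQubit, conjTranspose_tensorProd, tensorProd_mul]

theorem conjTranspose_mul_self_unitary (V : unitaryGroup (Fin 2) ℂ) :
    (V : Matrix (Fin 2) (Fin 2) ℂ)ᴴ * (V : Matrix (Fin 2) (Fin 2) ℂ) = 1 :=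
  mem_unitaryGroup_iff'.mp V.2

/-- A two-qubit term on `k`, `l` does not flip any other qubit. -/
theorem localBasisChange_two_qubit_apply_eq_zero {n : ℕ} (U : Fin n → unitaryGroup (Fin 2) ℂ)
    (P : Matrix (Fin 2) (Fin 2) ℂ) {k l m : Fin n} (hk : m ≠ k) (hl : m ≠ l)
    {x y : BitString n} (h : x m ≠ y m) :
    localBasisChange U (onQubit P k * onQubit P l) x y = 0 := by
  rw [localBasisChange_two_qubit]
  refine Finset.prod_eq_zero (Finset.mem_univ m) ?_
  simp [Function.update_of_ne hk, Function.update_of_ne hl, conjTranspose_mul_self_unitary,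
    Matrix.one_apply_ne h]

theorem localBasisChange_two_qubit_apply {n : ℕ} (U : Fin n → unitaryGroup (Fin 2) ℂ)
    (P : Matrix (Fin 2) (Fin 2) ℂ) {i j : Fin n} (hij : i ≠ j) {x y : BitString n}
    (h : ∀ m, m ≠ i → m ≠ j → x m = y m) :
    localBasisChange U (onQubit P i * onQubit P j) x y =
      ((U i : Matrix (Fin 2) (Fin 2) ℂ)ᴴ * P * (U i : Matrix (Fin 2) (Fin 2) ℂ)) (x i) (y i) *
      ((U j : Matrix (Fin 2) (Fin 2) ℂ)ᴴ * P * (U j : Matrix (Fin 2) (Fin 2) ℂ)) (x j) (y j) := by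
  rw [localBasisChange_two_qubit]
  simp only [tensorProd, Matrix.of_apply]
  rw [Fintype.prod_eq_mul i j hij]
  · simp [Function.update_of_ne hij, Function.update_of_ne hij.symm]
  · rintro m ⟨hi, hj⟩
    simp [Function.update_of_ne hi, Function.update_of_ne hj, conjTranspose_mul_self_unitary,
      h m hi hj]

/-- `X ⊗ X + Y ⊗ Y + Z ⊗ Z = 2 SWAP - 1`, in a product basis. -/
theorem pauli_sum_apply (A B : Matrix (Fin 2) (Fin 2) ℂ) (a b c d : Fin 2) :
    (Aᴴ * pauliX * A) a b * (Bᴴ * pauliX * B) c d +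
      (Aᴴ * pauliY * A) a b * (Bᴴ * pauliY * B) c d +
      (Aᴴ * pauliZ * A) a b * (Bᴴ * pauliZ * B) c d =
    2 * ((Aᴴ * B) a d * star ((Aᴴ * B) b c)) - (Aᴴ * A) a b * (Bᴴ * B) c d := by
  simp only [Matrix.mul_apply, Fin.sum_univ_two, pauliX, pauliY, pauliZ, Matrix.of_apply,
    Matrix.cons_val', Matrix.cons_val_zero, Matrix.cons_val_one, Matrix.cons_val_fin_one,
    conjTranspose_apply, star_add, star_mul', star_star]
  -- Only the `Y ⊗ Y` term needs `I² = -1`; the rest is a polynomial identity.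
  linear_combination ((-star (A 1 a) * A 0 b + star (A 0 a) * A 1 b) *
    (-star (B 1 c) * B 0 d + star (B 0 c) * B 1 d)) * Complex.I_sq

/-- Any pair other than `{i, j}` misses a flipped bit and contributes zero, so no cancellation
between couplings can occur. -/
theorem localBasisChange_heisenberg_apply {n : ℕ} (U : Fin n → unitaryGroup (Fin 2) ℂ)
    (J : Fin n → Fin n → ℝ) {i j : Fin n} (hij : i < j) {x y : BitString n}
    (hi : x i ≠ y i) (hj : x j ≠ y j) (h : ∀ m, m ≠ i → m ≠ j → x m = y m) :
    localBasisChange U (heisenberg J) x y = (J i j : ℂ) *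
      (2 * (((U i : Matrix (Fin 2) (Fin 2) ℂ)ᴴ * (U j : Matrix (Fin 2) (Fin 2) ℂ)) (x i) (y j) *
        star (((U i : Matrix (Fin 2) (Fin 2) ℂ)ᴴ *
          (U j : Matrix (Fin 2) (Fin 2) ℂ)) (y i) (x j)))) := by
  have hzero : ∀ {k l m : Fin n}, m ≠ k → m ≠ l → x m ≠ y m →
      localBasisChange U (exchange k l) x y = 0 := by
    intro k l m hk hl hm
    simp [exchange, localBasisChange_add, Matrix.add_apply,
      localBasisChange_two_qubit_apply_eq_zero U _ hk hl hm]
  rw [localBasisChange_heisenberg]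
  simp only [Matrix.sum_apply, Matrix.smul_apply, smul_eq_mul]
  rw [Finset.sum_eq_single i, Finset.sum_eq_single j]
  -- The `-1` in `2 SWAP - 1` drops out because bit `i` is flipped.
  · rw [exchange, localBasisChange_add, localBasisChange_add, Matrix.add_apply, Matrix.add_apply,
      localBasisChange_two_qubit_apply U _ hij.ne h, localBasisChange_two_qubit_apply U _ hij.ne h,
      localBasisChange_two_qubit_apply U _ hij.ne h, pauli_sum_apply,
      conjTranspose_mul_self_unitary, Matrix.one_apply_ne hi, zero_mul, sub_zero]
  · intro l _ hl
    rw [hzero hij.ne' hl.symm hj, mul_zero]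
  · intro hj'
    exact absurd (Finset.mem_Ioi.mpr hij) hj'
  · intro k _ hk
    refine Finset.sum_eq_zero fun l hl => ?_
    have hkl := Finset.mem_Ioi.mp hl
    -- If `l = i`, then `k < i < j` and the pair misses `j`; otherwise it misses `i`.
    by_cases hil : i = l
    · subst hil
      rw [hzero (hkl.trans hij).ne' hij.ne' hj, mul_zero]
    · rw [hzero hk.symm hil hi, mul_zero]
  · intro hi'
    exact absurd (Finset.mem_univ i) hi'

/-! ### Constraints on relative rotations -/

/-- For a stoquastic Hamiltonian with antiferromagnetic coupling between `i` and `j`, the relative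
rotation `W = Uᵢ† Uⱼ` satisfies `⟨a|W|b⟩ ⟨a'|W|b'⟩* ≤ 0`, where `'` is the bit flip. -/
theorem IsStoquastic.relative_rotation {n : ℕ} {U : Fin n → unitaryGroup (Fin 2) ℂ}
    {J : Fin n → Fin n → ℝ} {i j : Fin n} (hij : i < j) (hJ : 0 < J i j)
    (hH : IsStoquastic (localBasisChange U (heisenberg J))) {a b c d : Fin 2}
    (hac : a ≠ c) (hbd : b ≠ d) :
    let W := (U i : Matrix (Fin 2) (Fin 2) ℂ)ᴴ * (U j : Matrix (Fin 2) (Fin 2) ℂ)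
    (W a b * star (W c d)).im = 0 ∧ (W a b * star (W c d)).re ≤ 0 := by
  intro W
  -- The formula reads `W (x i) (y j) * star (W (y i) (x j))`, hence the crossed placement of `b`
  -- and `d`.
  let x : BitString n := Function.update (Function.update (fun _ => 0) i a) j d
  let y : BitString n := Function.update (Function.update (fun _ => 0) i c) j b
  have hxi : x i = a := by simp [x, Function.update_of_ne hij.ne]
  have hyi : y i = c := by simp [y, Function.update_of_ne hij.ne]
  have hxj : x j = d := by simp [x]
  have hyj : y j = b := by simp [y]
  have hrest : ∀ m, m ≠ i → m ≠ j → x m = y m := by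
    intro m hi hj
    simp [x, y, Function.update_of_ne hi, Function.update_of_ne hj]
  have hi : x i ≠ y i := by rwa [hxi, hyi]
  have hj : x j ≠ y j := by rw [hxj, hyj]; exact hbd.symm
  have key := localBasisChange_heisenberg_apply U J hij hi hj hrest
  rw [hxi, hyi, hxj, hyj] at key
  have him := hH.1 x y
  have hre := hH.2 x y fun h => hi (congrFun h i)
  rw [key, Complex.im_ofReal_mul] at him
  rw [key, Complex.re_ofReal_mul] at hre
  have him2 := (mul_eq_zero.mp him).resolve_left hJ.ne'
  have hre2 := nonpos_of_mul_nonpos_right hre hJ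
  simp only [Complex.mul_re 2, Complex.mul_im 2, Complex.re_ofNat, Complex.im_ofNat,
    zero_mul, sub_zero, add_zero] at him2 hre2
  exact ⟨by linarith, by linarith⟩

/-- Equal moduli and `z w̄ ≤ 0` give `z w̄ = -|z|²`, so `|z + w|² = 0`. -/
theorem eq_neg_of_mul_star_nonpos {z w : ℂ} (hn : Complex.normSq z = Complex.normSq w)
    (him : (z * star w).im = 0) (hre : (z * star w).re ≤ 0) : w = -z := by
  have h : Complex.normSq (w + z) = 0 := by
    have hsq : (z * star w).re ^ 2 = Complex.normSq z ^ 2 := by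
      have := Complex.normSq_apply (z * star w)
      rw [him, Complex.normSq_mul, Complex.star_def, Complex.normSq_conj, ← hn] at this
      simp only [Complex.star_def]
      nlinarith
    have hre' : (z * star w).re = -Complex.normSq z := by
      rcases sq_eq_sq_iff_eq_or_eq_neg.mp hsq with h | h
      · linarith [Complex.normSq_nonneg z]
      · exact h
    simp only [Complex.star_def] at hre'
    rw [add_comm, Complex.normSq_add, hre', ← hn]
    ring
  exact eq_neg_of_add_eq_zero_left (Complex.normSq_eq_zero.mp h)

theorem normSq_entries_of_unitary {W : Matrix (Fin 2) (Fin 2) ℂ} (h₁ : W * Wᴴ = 1)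
    (h₂ : Wᴴ * W = 1) :
    Complex.normSq (W 0 0) = Complex.normSq (W 1 1) ∧
      Complex.normSq (W 0 1) = Complex.normSq (W 1 0) := by
  have e₁ := congrFun (congrFun h₁ 0) 0
  have e₂ := congrFun (congrFun h₁ 1) 1
  have e₃ := congrFun (congrFun h₂ 0) 0
  simp only [Matrix.mul_apply, Fin.sum_univ_two, conjTranspose_apply, Matrix.one_apply_eq,
    Complex.star_def, Complex.mul_conj, mul_comm ((starRingEnd ℂ) _)] at e₁ e₂ e₃
  norm_cast at e₁ e₂ e₃
  exact ⟨by linarith, by linarith⟩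

theorem IsStoquastic.relative_rotation_antisymm {n : ℕ} {U : Fin n → unitaryGroup (Fin 2) ℂ}
    {J : Fin n → Fin n → ℝ} {i j : Fin n} (hij : i < j) (hJ : 0 < J i j)
    (hH : IsStoquastic (localBasisChange U (heisenberg J))) :
    let W := (U i : Matrix (Fin 2) (Fin 2) ℂ)ᴴ * (U j : Matrix (Fin 2) (Fin 2) ℂ)
    W 1 1 = -W 0 0 ∧ W 1 0 = -W 0 1 := by
  intro W
  have hmem : W ∈ unitaryGroup (Fin 2) ℂ := mul_mem (Unitary.star_mem (U i).2) (U j).2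
  obtain ⟨n₁, n₂⟩ := normSq_entries_of_unitary (mem_unitaryGroup_iff.mp hmem)
    (mem_unitaryGroup_iff'.mp hmem)
  obtain ⟨a₁, a₂⟩ := hH.relative_rotation hij hJ (a := 0) (b := 0) (c := 1) (d := 1)
    (by decide) (by decide)
  obtain ⟨b₁, b₂⟩ := hH.relative_rotation hij hJ (a := 0) (b := 1) (c := 1) (d := 0)
    (by decide) (by decide)
  exact ⟨eq_neg_of_mul_star_nonpos n₁ a₁ a₂, eq_neg_of_mul_star_nonpos n₂ b₁ b₂⟩

/-- The hypotheses on `A` and `B` say that they anticommute with `X`, so `A * B` commutes with `X`;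
by the last hypothesis it also anticommutes, hence equals its own negative. -/
theorem mul_eq_zero_of_antisymm {A B : Matrix (Fin 2) (Fin 2) ℂ}
    (hA : A 1 1 = -A 0 0 ∧ A 1 0 = -A 0 1) (hB : B 1 1 = -B 0 0 ∧ B 1 0 = -B 0 1)
    (hAB : (A * B) 1 1 = -(A * B) 0 0 ∧ (A * B) 1 0 = -(A * B) 0 1) : A * B = 0 := by
  obtain ⟨h₁, h₂⟩ := hAB
  simp only [Matrix.mul_apply, Fin.sum_univ_two, hA.1, hA.2, hB.1, hB.2] at h₁ h₂
  ext i j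
  fin_cases i <;> fin_cases j <;>
    simp only [Fin.zero_eta, Fin.mk_one, Matrix.mul_apply, Fin.sum_univ_two, hA.1, hA.2, hB.1, hB.2,
      Matrix.zero_apply]
  · linear_combination h₁ / 2
  · linear_combination h₂ / 2
  · linear_combination h₂ / 2
  · linear_combination h₁ / 2

/-! ### Non-stoquasticity and the Haldane–Shastry couplings -/

theorem not_isStoquastic_heisenberg {n : ℕ} (hn : 2 ≤ n) {J : Fin n → Fin n → ℝ}
    (hJ : ∀ i j, i < j → 0 < J i j) : ¬ IsStoquastic (heisenberg J) := by
  intro hH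
  rw [← localBasisChange_one (heisenberg J)] at hH
  have hij : (⟨0, by omega⟩ : Fin n) < ⟨1, by omega⟩ := by simp
  -- Here `W = 1`, so `W 0 0 * star (W 1 1) = 1`, which is not nonpositive.
  have h := (hH.relative_rotation hij (hJ _ _ hij) (a := 0) (b := 0) (c := 1) (d := 1)
    (by decide) (by decide)).2
  norm_num at h

theorem not_isStoquastic_localBasisChange_heisenberg {n : ℕ} (hn : 3 ≤ n)
    {J : Fin n → Fin n → ℝ} (hJ : ∀ i j, i < j → 0 < J i j)
    (U : Fin n → unitaryGroup (Fin 2) ℂ) :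
    ¬ IsStoquastic (localBasisChange U (heisenberg J)) := by
  intro hH
  let i : Fin n := ⟨0, by omega⟩
  let j : Fin n := ⟨1, by omega⟩
  let k : Fin n := ⟨2, by omega⟩
  have hij : i < j := by simp [i, j]
  have hjk : j < k := by simp [j, k]
  have hik : i < k := hij.trans hjk
  have hmul : (U i : Matrix (Fin 2) (Fin 2) ℂ)ᴴ * (U j : Matrix (Fin 2) (Fin 2) ℂ) *
      ((U j : Matrix (Fin 2) (Fin 2) ℂ)ᴴ * (U k : Matrix (Fin 2) (Fin 2) ℂ)) =
      (U i : Matrix (Fin 2) (Fin 2) ℂ)ᴴ * (U k : Matrix (Fin 2) (Fin 2) ℂ) := by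
    have hj : (U j : Matrix (Fin 2) (Fin 2) ℂ) * (U j : Matrix (Fin 2) (Fin 2) ℂ)ᴴ = 1 :=
      mem_unitaryGroup_iff.mp (U j).2
    rw [Matrix.mul_assoc, ← Matrix.mul_assoc (U j : Matrix (Fin 2) (Fin 2) ℂ), hj, Matrix.one_mul]
  have hzero := mul_eq_zero_of_antisymm (hH.relative_rotation_antisymm hij (hJ _ _ hij))
    (hH.relative_rotation_antisymm hjk (hJ _ _ hjk))
    (by rw [hmul]; exact hH.relative_rotation_antisymm hik (hJ _ _ hik))
  rw [hmul] at hzero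
  have hmem : (U i : Matrix (Fin 2) (Fin 2) ℂ)ᴴ * (U k : Matrix (Fin 2) (Fin 2) ℂ) ∈
    unitaryGroup (Fin 2) ℂ := mul_mem (Unitary.star_mem (U i).2) (U k).2
  rw [hzero, mem_unitaryGroup_iff, zero_mul] at hmem
  exact zero_ne_one hmem

theorem haldaneShastryCoupling_pos {n : ℕ} {i j : Fin n} (hij : i < j) :
    0 < haldaneShastryCoupling n i j := by
  have hn : (0 : ℝ) < n := by exact_mod_cast i.pos
  have hlt : (((i : ℕ) : ℝ)) < ((j : ℕ) : ℝ) := by exact_mod_cast hij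
  have hjn : (((j : ℕ) : ℝ)) < (n : ℝ) := by exact_mod_cast j.isLt
  have hi : (0 : ℝ) ≤ ((i : ℕ) : ℝ) := Nat.cast_nonneg _
  -- Since `-n < i - j < 0`, the angle lies strictly between `-π` and `0`; only nonvanishing of the
  -- sine matters, as it is squared.
  have hsin : Real.sin (Real.pi * (((i : ℕ) : ℝ) - ((j : ℕ) : ℝ)) / (n : ℝ)) < 0 := by
    apply Real.sin_neg_of_neg_of_neg_pi_lt
    · exact div_neg_of_neg_of_pos (mul_neg_of_pos_of_neg Real.pi_pos (by linarith)) hn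
    · rw [lt_div_iff₀ hn]
      nlinarith [Real.pi_pos]
  have hne : (n : ℝ) / Real.pi *
      Real.sin (Real.pi * (((i : ℕ) : ℝ) - ((j : ℕ) : ℝ)) / (n : ℝ)) ≠ 0 :=
    mul_ne_zero (div_pos hn Real.pi_pos).ne' hsin.ne
  unfold haldaneShastryCoupling
  positivity

end Qubits

theorem mainTheorem7 :
    -- no Hamiltonian of the family is stoquastic
    (∀ n : ℕ, 2 ≤ n → ∀ J : Fin n → Fin n → ℝ, (∀ i j, i < j → 0 < J i j) →
      ¬ Qubits.IsStoquastic (Qubits.heisenberg J)) ∧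
    -- for large `n`, uniformly in the couplings, no product unitary makes it stoquastic
    (∃ N : ℕ, ∀ n : ℕ, N ≤ n → ∀ J : Fin n → Fin n → ℝ, (∀ i j, i < j → 0 < J i j) →
      ∀ U : Fin n → Matrix.unitaryGroup (Fin 2) ℂ,
        ¬ Qubits.IsStoquastic (Qubits.localBasisChange U (Qubits.heisenberg J))) ∧
    -- the Haldane–Shastry Hamiltonian belongs to the family, so both claims hold for it
    (∀ n : ℕ, 2 ≤ n → ∀ i j : Fin n, i < j → 0 < Qubits.haldaneShastryCoupling n i j) ∧
    (∀ n : ℕ, 2 ≤ n → ¬ Qubits.IsStoquastic (Qubits.haldaneShastry n)) ∧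
    (∃ N : ℕ, ∀ n : ℕ, N ≤ n → ∀ U : Fin n → Matrix.unitaryGroup (Fin 2) ℂ,
      ¬ Qubits.IsStoquastic (Qubits.localBasisChange U (Qubits.haldaneShastry n))) := by
  refine ⟨fun n hn J hJ => Qubits.not_isStoquastic_heisenberg hn hJ,
    ⟨3, fun n hn J hJ U => Qubits.not_isStoquastic_localBasisChange_heisenberg hn hJ U⟩,
    fun n _ i j hij => Qubits.haldaneShastryCoupling_pos hij,
    fun n hn => Qubits.not_isStoquastic_heisenberg hn
      fun i j hij => Qubits.haldaneShastryCoupling_pos hij,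
    ⟨3, fun n hn U => Qubits.not_isStoquastic_localBasisChange_heisenberg hn
      (fun i j hij => Qubits.haldaneShastryCoupling_pos hij) U⟩⟩
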